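/- **Setting.** Let $\mathbb X\subset\mathbb R^n$ be Lebesgue measurable and consider a continuous-time Markov process on $\mathbb X$ with transition probabilities $P^t(x,B)=\int_B p^t(x,y)\,dy$ ($t>0$), where each $p^t\ge 0$ is jointly measurable. Assume that there is a unique stationary probability measure $\mu$, that $d\mu=\pi\,dx$ with $\pi$ continuous and strictly positive, and that detailed balance $p^t(x,y)\pi(x)=p^t(y,x)\pi(y)$ holds for all $x,y\in\mathbb X$, $t>0$. For $f:\mathbb X\times\mathbb X\to\mathbb R$ put $\|f\|_{\mathbb K}=\int_{\mathbb X}\int_{\mathbb X}|f(x,y)|\,dy\,d\mu(x)$, and let $L^2_{1/\pi}$ be the space with norm $\|f\|_{L^2_{1/\pi}}^2=\int_{\mathbb X}|f|^2/\pi\,dx$. A domain is a nonempty connected open set. **Lumpability.** Let $\mathbb Z\subset\mathbb R^r$ be a domain with Lebesgue measure $|\mathbb Z|$ (with $1/\infty=0$). The system is $\varepsilon$-lumpable with respect to a continuous $\xi:\mathbb X\to\mathbb Z$, with lag time $\tau>0$ and measurable functions $p_L^t:\mathbb Z\times\mathbb X\to[0,\infty)$, if $$\frac1{|\mathbb Z|}\,\big\|p^t(\ast,\cdot)-p_L^t(\xi(\ast),\cdot)\big\|_{\mathbb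 K}\le\varepsilon\qquad\text{for all } t\ge\tau .$$ **Weak reducibility.** Let $\varepsilon>0$, $r\le n$, $\tau>0$, assume $p^\tau(x,\cdot)\in L^2_{1/\pi}$ for all $x\in\mathbb X$, and let $\mathbb P_\tau=\{p^\tau(x,\cdot):x\in\mathbb X\}\subset L^2_{1/\pi}$. Let $\mathbb M\subset\mathbb P_\tau$ be an $r$-dimensionally parametrizable manifold, i.e. there is a homeomorphism (parametrization) $\mathcal E$ of $\mathbb M$, with the topology of $L^2_{1/\pi}$, onto a domain $\mathbb Z\subset\mathbb R^r$. Let $\mathcal Q:\mathbb P_\tau\to\mathbb M$ be a nearest point projection, that is, $\|p-\mathcal Q(p)\|_{L^2_{1/\pi}}=\min_{q\in\mathbb M}\|p-q\|_{L^2_{1/\pi}}$ for all $p\in\mathbb P_\tau$. Write $\mathcal Q(x):=\mathcal Q(p^\tau(x,\cdot))$ and let $$\xi(x):=\mathcal E\big(\mathcal Q(p^\tau(x,\cdot))\big),\qquad x\in\mathbb X,$$ be the transition manifold reaction coordinate. Suppose that $\xi$ is differentiable on $\mathbb X$ with $\det(\nabla\xi^\intercal\nabla\xi)\neq0$ almost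 everywhere on $\mathbb X$. For $x\in\mathbb X$ let $\mu_{\mathcal Q(x)}$ be the measure on the level set $\{x'\in\mathbb X:\mathcal Q(x')=\mathcal Q(x)\}=\{x'\in\mathbb X:\xi(x')=\xi(x)\}$ given by $$d\mu_{\mathcal Q(x)}=\pi\,\det(\nabla\xi^\intercal\nabla\xi)^{-1/2}\,dH_{n-r},$$ with $H_{n-r}$ the $(n-r)$-dimensional Hausdorff measure, normalized to be Lebesgue measure on $\mathbb R^{n-r}$. Then $\mathbb M$ (with $\mathcal E$, $\mathcal Q$) is a weak transition manifold if for all $x\in\mathbb X$ $$\int_{\{x':\,\mathcal Q(x')=\mathcal Q(x)\}}\big\|\mathcal Q(p^\tau(x',\cdot))-p^\tau(x',\cdot)\big\|_{L^2_{1/\pi}}\,d\mu_{\mathcal Q(x)}(x')\le\varepsilon ,$$ and the system is weakly $(\varepsilon,r,\tau)$-reducible if a weak transition manifold exists. **Proposition.** Let the system be weakly $(\varepsilon,r,\tau)$-reducible. Then it is $\varepsilon$-lumpable with lag time $\tau$. More precisely, for every weak transition manifold $\mathbb M$ with parametrization $\mathcal E$ and nearest point projection $\mathcal Q$, the system is $\varepsilon$-lumpable,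 with lag time $\tau$, with respect to the domain $\mathbb Z=\mathcal E(\mathbb M)$ and the transition manifold reaction coordinate $\xi=\mathcal E(\mathcal Q(p^\tau(x,\cdot)))$ (which is continuous), for a family $p_L^t$, $t\ge\tau$, of measurable functions $\mathbb Z\times\mathbb X\to[0,\infty)$ with $p_L^\tau(z,\cdot)=\mathcal E^{-1}(z)$ in $L^2_{1/\pi}$ for every $z\in\mathbb Z$. -/

import Mathlib

open MeasureTheory ProbabilityTheory
open scoped ENNReal

noncomputable section

/-- Euclidean space of dimension `n`. -/
abbrev Euc (n : ℕ) : Type := EuclideanSpace ℝ (Fin n)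

/-- Lebesgue measure on a Lebesgue-measurable set `X ⊆ ℝⁿ`, as a measure on the subtype. -/
def lebesgueOn {n : ℕ} (X : Set (Euc n)) : Measure X :=
  Measure.comap Subtype.val (volume : Measure (Euc n))

/-- A reversible Markov system in continuous time on a Lebesgue-measurable state space `X ⊆ ℝⁿ`,
given by its transition probability function `P t x B` for `t > 0`, with transition densities
`p t x y` and with a unique stationary law, which has a continuous positive density `dens`.
`X` carries its Borel sigma-algebra and the restriction `lebesgueOn X` of Lebesgue measure. -/
structure MarkovSystem (n : ℕ) where
  /-- the state space -/
  X : Set (Euc n)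
  nullMeasurableSet_X : NullMeasurableSet X (volume : Measure (Euc n))
  /-- the transition probability function -/
  P : ℝ → Kernel X X
  isMarkovKernel : ∀ t : ℝ, 0 < t → IsMarkovKernel (P t)
  chapman_kolmogorov : ∀ s t : ℝ, 0 < s → 0 < t → P (s + t) = P t ∘ₖ P s
  /-- the transition densities -/
  p : ℝ → X → X → ℝ
  p_nonneg : ∀ t : ℝ, 0 < t → ∀ x y, 0 ≤ p t x y
  p_measurable : ∀ t : ℝ, 0 < t → Measurable (Function.uncurry (p t))
  P_eq : ∀ t : ℝ, 0 < t → ∀ x,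
    P t x = (lebesgueOn X).withDensity (fun y => ENNReal.ofReal (p t x y))
  /-- the stationary density, usually written `π` -/
  dens : X → ℝ
  dens_continuous : Continuous dens
  dens_pos : ∀ x, 0 < dens x
  isProbabilityMeasure_dens :
    IsProbabilityMeasure ((lebesgueOn X).withDensity (fun x => ENNReal.ofReal (dens x)))
  stationary : ∀ t : ℝ, 0 < t →
    Kernel.Invariant (P t)
      ((lebesgueOn X).withDensity (fun x => ENNReal.ofReal (dens x)))
  stationary_unique : ∀ ν : Measure X, IsProbabilityMeasure ν →
    (∀ t : ℝ, 0 < t → Kernel.Invariant (P t) ν) →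
      ν = (lebesgueOn X).withDensity (fun x => ENNReal.ofReal (dens x))
  detailed_balance : ∀ t : ℝ, 0 < t → ∀ x y, p t x y * dens x = p t y x * dens y

namespace MarkovSystem

variable {n : ℕ} (S : MarkovSystem n)

/-- The stationary measure `dμ = π dx`. -/
def μ : Measure S.X :=
  (lebesgueOn S.X).withDensity (fun x => ENNReal.ofReal (S.dens x))

/-- The measure `dx / π`, so that `L²_{1/π}` is `Lp ℝ 2 S.invWeight`. -/
def invWeight : Measure S.X :=
  (lebesgueOn S.X).withDensity (fun x => ENNReal.ofReal (1 / S.dens x))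

/-- The norm of `L¹(μ × dx)`, as an iterated integral: first in the second argument with respect
to Lebesgue measure, then in the first argument with respect to `μ`. -/
def kNorm (f : S.X → S.X → ℝ) : ℝ≥0∞ :=
  ∫⁻ x, (∫⁻ y, ‖f x y‖ₑ ∂lebesgueOn S.X) ∂S.μ

/-- The derivative at `x` (within the state space) of a map `ξ : X → ℝʳ`. -/
def deriv {r : ℕ} (ξ : S.X → Euc r) (x : S.X) : Euc n →L[ℝ] Euc r :=
  fderivWithin ℝ (Function.extend Subtype.val ξ 0) S.X (x : Euc n)

/-- The Gram determinant `det (∇ξ(x)ᵀ ∇ξ(x))` of the `r` gradients of the components of `ξ`. -/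
def gramDet {r : ℕ} (ξ : S.X → Euc r) (x : S.X) : ℝ :=
  ((S.deriv ξ x).comp (ContinuousLinearMap.adjoint (S.deriv ξ x))).det

/-- The marginal stationary measure `μ_z` on the level set `{ξ = z}`:
`dμ_z = π det(∇ξᵀ∇ξ)^{-1/2} dH_{n-r}`, where `H_{n-r}` is the Hausdorff measure in the
normalization for which it is Lebesgue measure on `ℝ^{n-r}`. -/
def levelMeasure {r : ℕ} (ξ : S.X → Euc r) (z : Euc r) : Measure S.X :=
  ((Measure.euclideanHausdorffMeasure (n - r) : Measure S.X).restrict {x | ξ x = z}).withDensity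
    (fun x => ENNReal.ofReal (S.dens x) / ENNReal.ofReal (Real.sqrt (S.gramDet ξ x)))

/-- The lumpability condition with tolerance `ε` and lag time `τ`, for the reaction coordinate
`ξ : X → Z`, where `Z ⊆ ℝʳ` is a domain, and the reduced densities `pL t : Z × X → [0, ∞)`. -/
structure IsLumpableVia {r : ℕ} (ε τ : ℝ) (Z : Set (Euc r)) (ξ : C(S.X, Z))
    (pL : ℝ → Z → S.X → ℝ) : Prop where
  lag_pos : 0 < τ
  isOpen : IsOpen Z
  isConnected : IsConnected Z
  nonneg : ∀ t, τ ≤ t → ∀ z y, 0 ≤ pL t z y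
  measurable : ∀ t, τ ≤ t → Measurable (Function.uncurry (pL t))
  bound : ∀ t, τ ≤ t →
    (volume Z)⁻¹ * S.kNorm (fun x y => S.p t x y - pL t (ξ x) y) ≤ ENNReal.ofReal ε

/-- The transition densities at time `τ` lie in `L²_{1/π}`. -/
def HasL2Densities (τ : ℝ) : Prop := ∀ x, MemLp (S.p τ x) 2 S.invWeight

variable {S}

/-- `p^τ(x, ·)` as an element of `L²_{1/π}`. -/
def density {τ : ℝ} (hp : S.HasL2Densities τ) (x : S.X) : Lp ℝ 2 S.invWeight :=
  (hp x).toLp (S.p τ x)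

/-- An `r`-dimensionally parametrizable manifold `M ⊆ ℙ_τ`, where `ℙ_τ` is the set of all
`p^τ(x, ·)` in `L²_{1/π}`, with a parametrization (a homeomorphism of `M` onto a domain of `ℝʳ`)
and a nearest point projection of `ℙ_τ` onto `M`. -/
structure ParametrizedManifold {τ : ℝ} (hp : S.HasL2Densities τ) (r : ℕ) where
  /-- the manifold -/
  M : Set (Lp ℝ 2 S.invWeight)
  subset : M ⊆ Set.range (density hp)
  /-- the range of the parametrization -/
  Z : Set (Euc r)
  isOpen : IsOpen Z
  isConnected : IsConnected Z
  /-- the parametrization -/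
  E : M ≃ₜ Z
  /-- the nearest point projection -/
  Q : Set.range (density hp) → M
  Q_nearest : ∀ f : Set.range (density hp), ∀ g ∈ M,
    ‖(f : Lp ℝ 2 S.invWeight) - Q f‖ ≤ ‖(f : Lp ℝ 2 S.invWeight) - g‖

namespace ParametrizedManifold

variable {τ : ℝ} {hp : S.HasL2Densities τ} {r : ℕ} (W : ParametrizedManifold hp r)

/-- The projection `Q(p^τ(x, ·))` of the density with starting point `x`. -/
def proj (x : S.X) : W.M := W.Q ⟨density hp x, Set.mem_range_self x⟩

/-- The transition manifold reaction coordinate `ξ(x) = E(Q(p^τ(x, ·)))`, with values in `Z`. -/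
def rc (x : S.X) : W.Z := W.E (W.proj x)

/-- The reaction coordinate as a map into `ℝʳ`. -/
def rcVal (x : S.X) : Euc r := W.rc x

/-- A weak transition manifold with tolerance `ε`. The measure on the level set of `Q` through
`x` is the marginal stationary measure of the level set of `ξ = E ∘ Q` through `x`, which is the
same set. The first two fields say that the gradient of `ξ` exists and that its Gram determinant
is nonzero almost everywhere, as the definition of that measure requires. -/
structure IsWeakTransitionManifold (ε : ℝ) : Prop where
  differentiableOn : DifferentiableOn ℝ (Function.extend Subtype.val W.rcVal 0) S.X
  gramDet_ne_zero : ∀ᵐ x : S.X ∂lebesgueOn S.X, S.gramDet W.rcVal x ≠ 0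
  close : ∀ x : S.X,
    ∫⁻ x' in {x' | W.proj x' = W.proj x},
      ‖(W.proj x' : Lp ℝ 2 S.invWeight) - density hp x'‖ₑ
        ∂(S.levelMeasure W.rcVal (W.rcVal x)) ≤ ENNReal.ofReal ε

end ParametrizedManifold

/-- Weak `(ε, r, τ)`-reducibility. -/
def IsWeaklyReducible (ε : ℝ) (r : ℕ) {τ : ℝ} (hp : S.HasL2Densities τ) : Prop :=
  ∃ W : ParametrizedManifold hp r, W.IsWeakTransitionManifold ε

end MarkovSystem

end

/-! Since `M` lies in ℙ_τ, every z ∈ Z has a point σ(z) with p^τ(σ(z),·) = E⁻¹(z), and p_L^t(z,·) is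
taken to be p^t(σ(z),·). By Chapman–Kolmogorov, the L¹ distance of p^t(x,·) and p^t(x',·) does not
increase with t (`lintegral_enorm_p_sub_le`). By Cauchy–Schwarz, the L¹ norm is at most the norm of
L²_{1/π}, because π has mass 1. Hence for all t ≥ τ the L¹ error at x is at most ‖p^τ(x,·) − Q(x)‖.
Integrated over the level sets of ξ and then over Z, this is at most ε|Z|.

Only one half of the coarea formula is needed, ∫ g dμ ≤ ∫ ∫ g dμ_z dz
(`lintegral_μ_le_lintegral_levelMeasure`). This half holds for lower integrals, so measurability in
z of the inner integral never matters. Locally ξ is close to a linear map L with nonzero Gram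
determinant. Completing ξ by the projection onto ker L gives a self-map of ℝⁿ that scales volume by
about √det(LLᵀ). Fubini then bounds the volume of the image by the Hausdorff measures of the level
sets.

The choice σ need not be measurable. Since E⁻¹ is continuous, z ↦ P^t(σ(z),B) is still continuous,
and a Radon–Nikodym derivative of kernels supplies a jointly measurable version of p^t(σ(z),y)
(`exists_measurable_density`). -/

/-! ### The coarea inequality -/

/-! ### Gram determinants of linear maps. -/

section Gram

open Module

variable {E F : Type*} [NormedAddCommGroup E] [InnerProductSpace ℝ E] [FiniteDimensional ℝ E]
  [NormedAddCommGroup F] [InnerProductSpace ℝ F] [FiniteDimensional ℝ F]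

/-- The Gram determinant `det (L Lᵀ)` of a linear map. -/
noncomputable def ContinuousLinearMap.gram (L : E →L[ℝ] F) : ℝ :=
  (L.comp (ContinuousLinearMap.adjoint L)).det

theorem ContinuousLinearMap.surjective_of_gram_ne_zero {L : E →L[ℝ] F} (hL : L.gram ≠ 0) :
    Function.Surjective L := by
  intro z
  let e := (L.comp (ContinuousLinearMap.adjoint L)).toContinuousLinearEquivOfDetNeZero hL
  refine ⟨ContinuousLinearMap.adjoint L (e.symm z), ?_⟩
  exact e.apply_symm_apply z

theorem LinearMap.det_adjoint_real (M : F →ₗ[ℝ] F) :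
    LinearMap.det (LinearMap.adjoint M) = LinearMap.det M := by
  let b := stdOrthonormalBasis ℝ F
  rw [← LinearMap.det_toMatrix b.toBasis, ← LinearMap.det_toMatrix b.toBasis,
    LinearMap.toMatrix_adjoint, Matrix.det_conjTranspose]
  simp

/-- The linear map `x ↦ P x + U (L x)`, where `P` is the projection onto the kernel of `L` and `U`
identifies the target of `L` with the orthogonal complement of the kernel. -/
noncomputable def ContinuousLinearMap.kerCompletion (L : E →L[ℝ] F)
    (U : F ≃ₗᵢ[ℝ] (LinearMap.ker L.toLinearMap)ᗮ) : E →L[ℝ] E :=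
  (LinearMap.ker L.toLinearMap).starProjection +
    (Submodule.subtypeL _).comp
      ((U.toContinuousLinearEquiv : F →L[ℝ] (LinearMap.ker L.toLinearMap)ᗮ).comp L)

/-- With K = ker L and M = L|_{Kᗮ} ∘ U, one has LLᵀ = MMᵀ because L vanishes on K. On K ⊕ Kᗮ the
completion is block diagonal, with blocks the identity and a conjugate of M. Both sides are
therefore det(M)². -/
theorem ContinuousLinearMap.gram_eq_sq_det_kerCompletion (L : E →L[ℝ] F)
    (U : F ≃ₗᵢ[ℝ] (LinearMap.ker L.toLinearMap)ᗮ) :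
    L.gram = (L.kerCompletion U).det ^ 2 := by
  let K := LinearMap.ker L.toLinearMap
  let M : F →ₗ[ℝ] F := L.toLinearMap ∘ₗ Kᗮ.subtype ∘ₗ U.toLinearEquiv.toLinearMap
  have hLperp (x : E) : L (Kᗮ.orthogonalProjectionOnto x : E) = L x := by
    have h : (K.orthogonalProjectionOnto x : E) + Kᗮ.orthogonalProjectionOnto x = x := by
      have := K.orthogonalDecomposition.symm_apply_apply x
      rwa [Submodule.orthogonalDecomposition_symm_apply,
        Submodule.orthogonalDecomposition_apply] at this
    have h0 : L (K.orthogonalProjectionOnto x : E) = 0 :=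
      (K.orthogonalProjectionOnto x).2
    conv_rhs => rw [← h, map_add, h0, zero_add]
  have hgram : L.gram = LinearMap.det M ^ 2 := by
    have h1 : (L.comp (ContinuousLinearMap.adjoint L)).toLinearMap = M ∘ₗ LinearMap.adjoint M := by
      refine LinearMap.ext fun z => ?_
      have h2 : LinearMap.adjoint M z
          = U.symm (Kᗮ.orthogonalProjectionOnto (ContinuousLinearMap.adjoint L z)) := by
        refine ext_inner_right ℝ fun w => ?_
        rw [LinearMap.adjoint_inner_left, ← U.inner_map_map (U.symm _), U.apply_symm_apply,
          Submodule.inner_orthogonalProjectionOnto_eq_of_mem_right]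
        exact (ContinuousLinearMap.adjoint_inner_left L _ _).symm
      rw [LinearMap.comp_apply, h2]
      simp only [M, LinearMap.comp_apply]
      have h3 : U.toLinearEquiv.toLinearMap
          (U.symm (Kᗮ.orthogonalProjectionOnto (ContinuousLinearMap.adjoint L z)))
          = Kᗮ.orthogonalProjectionOnto (ContinuousLinearMap.adjoint L z) :=
        U.apply_symm_apply _
      rw [h3]
      exact (hLperp _).symm
    rw [ContinuousLinearMap.gram, ContinuousLinearMap.det, h1, LinearMap.det_comp,
      LinearMap.det_adjoint_real, sq]
  let N : Kᗮ →ₗ[ℝ] Kᗮ := U.toLinearEquiv.toLinearMap ∘ₗ L.toLinearMap ∘ₗ Kᗮ.subtype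
  have hN : LinearMap.det N = LinearMap.det M := by
    rw [← LinearMap.det_conj M U.toLinearEquiv]
    congr 1
    refine LinearMap.ext fun w => ?_
    simp [M, N]
  let D : E ≃ₗ[ℝ] K × Kᗮ :=
    K.orthogonalDecomposition.toLinearEquiv.trans (WithLp.linearEquiv 2 ℝ (K × Kᗮ))
  have hdet : (L.kerCompletion U).det = LinearMap.det N := by
    rw [ContinuousLinearMap.det, ← LinearMap.det_conj _ D, ← one_mul (LinearMap.det N),
      ← LinearMap.det_id (M := K), ← LinearMap.det_prodMap]
    congr 1
    refine LinearMap.ext fun w => ?_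
    obtain ⟨k, w⟩ := w
    have hs : D.symm (k, w) = (k : E) + (w : E) :=
      K.orthogonalDecomposition_symm_apply (WithLp.toLp 2 (k, w))
    have hk : L (k : E) = 0 := k.2
    have hval : L.kerCompletion U ((k : E) + w) = (k : E) + (N w : E) := by
      have hw : K.starProjection (w : E) = 0 :=
        (Submodule.starProjection_apply_eq_zero_iff K).2 w.2
      have hk' : K.starProjection (k : E) = k := Submodule.starProjection_eq_self_iff.2 k.2
      have h6 : L.kerCompletion U ((k : E) + w)
          = K.starProjection ((k : E) + w) + (U (L ((k : E) + w)) : E) := rfl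
      rw [h6, map_add, map_add, hk, hw, hk', add_zero, zero_add]
      rfl
    rw [LinearMap.comp_apply, LinearMap.comp_apply]
    refine D.symm.injective ?_
    have h5 : (D.symm : K × Kᗮ →ₗ[ℝ] E) (k, w) = (k : E) + (w : E) := hs
    rw [h5]
    refine (D.symm_apply_apply _).trans ?_
    refine hval.trans ?_
    exact (K.orthogonalDecomposition_symm_apply (WithLp.toLp 2 (k, N w))).symm
  rw [hgram, hdet, hN]

theorem ContinuousLinearMap.abs_det_kerCompletion (L : E →L[ℝ] F)
    (U : F ≃ₗᵢ[ℝ] (LinearMap.ker L.toLinearMap)ᗮ) :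
    |(L.kerCompletion U).det| = √L.gram := by
  rw [L.gram_eq_sq_det_kerCompletion U, Real.sqrt_sq_eq_abs]

theorem ContinuousLinearMap.continuous_gram :
    Continuous (ContinuousLinearMap.gram : (E →L[ℝ] F) → ℝ) := by
  refine ContinuousLinearMap.continuous_det.comp ?_
  exact continuous_id.clm_comp ContinuousLinearMap.adjoint.continuous

theorem ContinuousLinearMap.exists_linearIsometryEquiv_ker_orthogonal {L : E →L[ℝ] F}
    (hL : Function.Surjective L) :
    Nonempty (F ≃ₗᵢ[ℝ] (LinearMap.ker L.toLinearMap)ᗮ) := by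
  have h1 := L.toLinearMap.finrank_range_add_finrank_ker
  rw [LinearMap.range_eq_top.2 hL, finrank_top] at h1
  have h2 := (LinearMap.ker L.toLinearMap).finrank_add_finrank_orthogonal
  have h3 : finrank ℝ F = finrank ℝ (LinearMap.ker L.toLinearMap)ᗮ := by omega
  exact ⟨(stdOrthonormalBasis ℝ F).equiv (stdOrthonormalBasis ℝ _) (finCongr h3)⟩

theorem ContinuousLinearMap.gram_pos {L : E →L[ℝ] F} (hL : L.gram ≠ 0) : 0 < L.gram := by
  obtain ⟨U⟩ := exists_linearIsometryEquiv_ker_orthogonal (L.surjective_of_gram_ne_zero hL)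
  exact lt_of_le_of_ne (L.gram_eq_sq_det_kerCompletion U ▸ sq_nonneg _) (Ne.symm hL)

end Gram

/-! ### The coarea inequality between Euclidean spaces. -/

section Coarea

open Module Set Filter
open scoped NNReal Topology

variable {E F : Type*} [NormedAddCommGroup E] [InnerProductSpace ℝ E] [FiniteDimensional ℝ E]
  [MeasurableSpace E] [BorelSpace E]
  [NormedAddCommGroup F] [InnerProductSpace ℝ F] [FiniteDimensional ℝ F]
  [MeasurableSpace F] [BorelSpace F]

theorem Submodule.measurePreserving_add_orthogonal (K : Submodule ℝ E) :
    MeasurePreserving (fun q : K × Kᗮ => (q.1 : E) + (q.2 : E)) volume volume := by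
  have h := (K.orthogonalDecomposition.symm.measurePreserving).comp
    (WithLp.volume_preserving_toLp K Kᗮ)
  convert! h using 1

theorem Submodule.euclideanHausdorffMeasure_orthogonalProjectionOnto_image_le
    (K : Submodule ℝ E) (s : Set E) :
    volume (K.orthogonalProjectionOnto '' s) ≤ Measure.euclideanHausdorffMeasure (finrank ℝ K) s := by
  rw [← InnerProductSpace.euclideanHausdorffMeasure_eq_volume,
    Measure.euclideanHausdorffMeasure_def, Measure.euclideanHausdorffMeasure_def,
    Measure.smul_apply, Measure.smul_apply]
  gcongr
  simpa using K.lipschitzWith_orthogonalProjectionOnto.hausdorffMeasure_image_le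
    (Nat.cast_nonneg (finrank ℝ K)) s

/-- Fubini on K × Kᗮ: the slice of the image over U z lies in the projection of A ∩ f⁻¹{z} to K, and
the projection, being 1-Lipschitz, does not increase Hausdorff measure. -/
theorem volume_image_le_lintegral_slices (K : Submodule ℝ E) (U : F ≃ₗᵢ[ℝ] Kᗮ) (f : E → F)
    {A : Set E}
    (hA : MeasurableSet ((fun x => K.starProjection x + (U (f x) : E)) '' A)) :
    volume ((fun x => K.starProjection x + (U (f x) : E)) '' A)
      ≤ ∫⁻ z, Measure.euclideanHausdorffMeasure (finrank ℝ K) (A ∩ f ⁻¹' {z}) := by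
  have hmp := K.measurePreserving_add_orthogonal
  rw [← hmp.measure_preimage hA.nullMeasurableSet, Measure.volume_eq_prod,
    Measure.prod_apply_symm (hmp.measurable hA),
    ← U.measurePreserving.lintegral_comp (measurable_measure_prodMk_right (hmp.measurable hA))]
  refine lintegral_mono fun z => ?_
  refine (measure_mono ?_).trans
    (K.euclideanHausdorffMeasure_orthogonalProjectionOnto_image_le (A ∩ f ⁻¹' {z}))
  rintro k ⟨x, hxA, hx⟩
  have h' (a : K) (b : Kᗮ) : K.orthogonalProjectionOnto ((a : E) + b) = a ∧
      Kᗮ.orthogonalProjectionOnto ((a : E) + b) = b := by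
    have := K.orthogonalDecomposition.apply_symm_apply (WithLp.toLp 2 (a, b))
    rw [K.orthogonalDecomposition_symm_apply, K.orthogonalDecomposition_apply] at this
    have h2 := congrArg WithLp.ofLp this
    exact ⟨congrArg Prod.fst h2, congrArg Prod.snd h2⟩
  have h3 := congrArg K.orthogonalProjectionOnto hx
  have h4 := congrArg Kᗮ.orthogonalProjectionOnto hx
  simp only [Submodule.starProjection_apply, (h' _ _).1, (h' _ _).2] at h3 h4
  exact ⟨x, ⟨hxA, U.injective h4⟩, h3⟩

theorem exists_approximatesLinearOn_coarea_le {L : E →L[ℝ] F} (hL : L.gram ≠ 0) {t : ℝ}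
    (ht : 1 < t) :
    ∃ c : ℝ≥0, 0 < c ∧ ∀ (A : Set E) (f : E → F), MeasurableSet A →
      ApproximatesLinearOn f L A c →
        ENNReal.ofReal (√L.gram) * volume A ≤ ENNReal.ofReal t *
          ∫⁻ z, Measure.euclideanHausdorffMeasure (finrank ℝ E - finrank ℝ F) (A ∩ f ⁻¹' {z}) := by
  have hsurj := L.surjective_of_gram_ne_zero hL
  obtain ⟨U⟩ := L.exists_linearIsometryEquiv_ker_orthogonal hsurj
  have hfin : finrank ℝ (LinearMap.ker L.toLinearMap) = finrank ℝ E - finrank ℝ F := by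
    have h1 := L.toLinearMap.finrank_range_add_finrank_ker
    rw [LinearMap.range_eq_top.2 hsurj, finrank_top] at h1
    omega
  have hdet : (L.kerCompletion U).det ≠ 0 := by
    intro h
    exact hL (by rw [L.gram_eq_sq_det_kerCompletion U, h]; simp)
  have habs : 0 < |(L.kerCompletion U).det| := abs_pos.2 hdet
  -- Strictly below |det|, as the lower volume bound for maps close to the completion requires; t·m
  -- recovers √gram.
  let m : ℝ≥0 := (|(L.kerCompletion U).det| / t).toNNReal
  have hm : (m : ℝ≥0∞) < ENNReal.ofReal |(L.kerCompletion U).det| := by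
    refine (ENNReal.ofReal_lt_ofReal_iff habs).2 ?_
    exact div_lt_self habs ht
  let e : E ≃L[ℝ] E := (L.kerCompletion U).toContinuousLinearEquivOfDetNeZero hdet
  -- A small c also makes the perturbed map injective on A, so the image of the Borel set A is
  -- measurable and Fubini applies.
  have hinj : ∀ᶠ c : ℝ≥0 in 𝓝[>] 0, Subsingleton E ∨ c < ‖(e.symm : E →L[ℝ] E)‖₊⁻¹ := by
    rcases subsingleton_or_nontrivial E with h | h
    · exact Eventually.of_forall fun _ => Or.inl h
    · have h0 : 0 < ‖(e.symm : E →L[ℝ] E)‖₊⁻¹ :=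
        inv_pos.2 e.nnnorm_symm_pos
      filter_upwards [nhdsWithin_le_nhds (Iio_mem_nhds h0)] with c hc using Or.inr hc
  obtain ⟨c, ⟨hc1, hc2⟩, hc3⟩ :=
    ((mul_le_addHaar_image_of_lt_det (volume : Measure E) (L.kerCompletion U) hm).and hinj
      |>.and self_mem_nhdsWithin).exists
  refine ⟨c, hc3, fun A f hA hf => ?_⟩
  let K := LinearMap.ker L.toLinearMap
  let Φ : E → E := fun x => K.starProjection x + (U (f x) : E)
  have hΦ : ApproximatesLinearOn Φ (L.kerCompletion U) A c := by
    intro x hx y hy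
    have h1 : Φ x - Φ y - L.kerCompletion U (x - y) = (U (f x - f y - L (x - y)) : E) := by
      have h2 : L.kerCompletion U (x - y) = K.starProjection (x - y) + (U (L (x - y)) : E) := rfl
      rw [h2, map_sub U, map_sub U]
      simp only [Φ, map_sub K.starProjection, AddSubgroupClass.coe_sub]
      abel
    rw [h1]
    exact (U.norm_map _).trans_le (hf x hx y hy)
  have hΦinj : InjOn Φ A := ApproximatesLinearOn.injOn (f' := e) hΦ hc2
  have hmeas : MeasurableSet (Φ '' A) := hA.image_of_continuousOn_injOn hΦ.continuousOn hΦinj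
  have h1 := hc1 A Φ hΦ
  have h2 := volume_image_le_lintegral_slices K U f hmeas
  rw [hfin] at h2
  have h3 : ENNReal.ofReal (√L.gram) = ENNReal.ofReal t * m := by
    rw [← L.abs_det_kerCompletion U]
    have : (m : ℝ≥0∞) = ENNReal.ofReal (|(L.kerCompletion U).det| / t) := rfl
    rw [this, ← ENNReal.ofReal_mul (by linarith)]
    congr 1
    field_simp
  rw [h3, mul_assoc]
  gcongr
  exact h1.trans h2

omit [MeasurableSpace E] [BorelSpace E] [MeasurableSpace F] [BorelSpace F] in
theorem exists_linearIsometry_of_finrank_le (hEF : finrank ℝ F ≤ finrank ℝ E) :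
    Nonempty (F →ₗᵢ[ℝ] E) := by
  let b := stdOrthonormalBasis ℝ F
  let b' := stdOrthonormalBasis ℝ E
  have hon : Orthonormal ℝ (fun i => b' (Fin.castLE hEF i)) :=
    b'.orthonormal.comp _ (Fin.castLE_injective hEF)
  exact ⟨(b.toBasis.constr ℝ fun i => b' (Fin.castLE hEF i)).isometryOfOrthonormal
    (v := b.toBasis) (by simp) (by
      convert hon using 1
      funext i
      simp)⟩

omit [MeasurableSpace F] [BorelSpace F] in
-- An isometric embedding of F into E reduces this to self-maps of E without changing norms.
theorem ApproximatesLinearOn.ae_norm_fderiv_sub_le (hEF : finrank ℝ F ≤ finrank ℝ E)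
    {f : E → F} {L : E →L[ℝ] F} {s : Set E} {c : ℝ≥0} (hf : ApproximatesLinearOn f L s c)
    (hs : MeasurableSet s) (f' : E → E →L[ℝ] F) (hf' : ∀ x ∈ s, HasFDerivWithinAt f (f' x) s x) :
    ∀ᵐ x ∂volume.restrict s, ‖f' x - L‖₊ ≤ c := by
  obtain ⟨ι⟩ := exists_linearIsometry_of_finrank_le hEF
  let ι' : F →L[ℝ] E := ι.toContinuousLinearMap
  have h1 : ApproximatesLinearOn (ι' ∘ f) (ι'.comp L) s c := by
    intro x hx y hy
    have h2 : (ι' ∘ f) x - (ι' ∘ f) y - (ι'.comp L) (x - y) = ι' (f x - f y - L (x - y)) := by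
      simp [map_sub]
    rw [h2]
    exact (ι.norm_map _).trans_le (hf x hx y hy)
  have h3 := h1.norm_fderiv_sub_le volume hs (fun x => ι'.comp (f' x))
    (fun x hx => ι'.hasFDerivAt.comp_hasFDerivWithinAt x (hf' x hx))
  filter_upwards [h3] with x hx
  rw [← ContinuousLinearMap.comp_sub] at hx
  have h4 : ‖ι'.comp (f' x - L)‖ = ‖f' x - L‖ := ι.norm_toContinuousLinearMap_comp
  exact NNReal.coe_le_coe.1 (h4.symm.trans_le (NNReal.coe_le_coe.2 hx))

omit [MeasurableSpace F] [BorelSpace F] in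
theorem aemeasurable_fderivWithin_of_finrank_le (hEF : finrank ℝ F ≤ finrank ℝ E)
    {f : E → F} {s : Set E} (hs : MeasurableSet s) {f' : E → E →L[ℝ] F}
    (hf' : ∀ x ∈ s, HasFDerivWithinAt f (f' x) s x) :
    AEMeasurable f' (volume.restrict s) := by
  obtain ⟨ι⟩ := exists_linearIsometry_of_finrank_le hEF
  let ι' : F →L[ℝ] E := ι.toContinuousLinearMap
  have h1 := aemeasurable_fderivWithin volume hs (f := ι' ∘ f) (f' := fun x => ι'.comp (f' x))
    (fun x hx => ι'.hasFDerivAt.comp_hasFDerivWithinAt x (hf' x hx))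
  have h2 : Continuous fun M : E →L[ℝ] E => (ContinuousLinearMap.adjoint ι').comp M :=
    continuous_const.clm_comp continuous_id
  convert h2.measurable.comp_aemeasurable h1 using 1
  funext x
  have h3 : (ContinuousLinearMap.adjoint ι').comp ι' = ContinuousLinearMap.id ℝ F :=
    ι'.norm_map_iff_adjoint_comp_self.1 ι.norm_map
  simp only [Function.comp_apply]
  rw [← ContinuousLinearMap.comp_assoc, h3, ContinuousLinearMap.id_comp]

/-- Lower integrals are superadditive, so the functions need not be measurable. -/
theorem tsum_lintegral_le_lintegral_tsum {α : Type*} [MeasurableSpace α] (μ : Measure α)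
    (g : ℕ → α → ℝ≥0∞) : ∑' i, ∫⁻ a, g i a ∂μ ≤ ∫⁻ a, ∑' i, g i a ∂μ := by
  refine ENNReal.tsum_le_of_sum_range_le fun k => ?_
  have h : ∑ i ∈ Finset.range k, ∫⁻ a, g i a ∂μ ≤ ∫⁻ a, ∑ i ∈ Finset.range k, g i a ∂μ := by
    induction k with
    | zero => simp
    | succ k ih =>
      simp only [Finset.sum_range_succ]
      exact (add_le_add_left ih _).trans (le_lintegral_add _ _)
  exact h.trans (lintegral_mono fun a => ENNReal.sum_le_tsum _)

/-- The set s is cut into countably many pieces on which f is nearly linear. Each piece costs one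
factor t for the volume estimate and one for comparing √gram of f' with that of the linear model;
finally t → 1. -/
theorem lintegral_gram_le_lintegral_slices {f : E → F} {s : Set E} (hs : MeasurableSet s)
    {f' : E → E →L[ℝ] F} (hf' : ∀ x ∈ s, HasFDerivWithinAt f (f' x) s x)
    (hgram : ∀ x ∈ s, (f' x).gram ≠ 0) :
    ∫⁻ x in s, ENNReal.ofReal (√(f' x).gram)
      ≤ ∫⁻ z, Measure.euclideanHausdorffMeasure (finrank ℝ E - finrank ℝ F) (s ∩ f ⁻¹' {z}) := by
  rcases s.eq_empty_or_nonempty with rfl | hne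
  · simp
  have hEF : finrank ℝ F ≤ finrank ℝ E := by
    obtain ⟨x, hx⟩ := hne
    have := (f' x).surjective_of_gram_ne_zero (hgram x hx)
    exact LinearMap.finrank_le_finrank_of_surjective (f := (f' x).toLinearMap) this
  set I := ∫⁻ z, Measure.euclideanHausdorffMeasure (finrank ℝ E - finrank ℝ F) (s ∩ f ⁻¹' {z})
  have key (t : ℝ) (ht : 1 < t) :
      ∫⁻ x in s, ENNReal.ofReal (√(f' x).gram) ≤ ENNReal.ofReal (t * t) * I := by
    have hexists (L : E →L[ℝ] F) : ∃ c : ℝ≥0, c ≠ 0 ∧ (L.gram ≠ 0 →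
        (∀ M : E →L[ℝ] F, ‖M - L‖₊ ≤ c → √M.gram ≤ t * √L.gram) ∧
        ∀ (A : Set E) (f : E → F), MeasurableSet A → ApproximatesLinearOn f L A c →
          ENNReal.ofReal (√L.gram) * volume A ≤ ENNReal.ofReal t *
            ∫⁻ z, Measure.euclideanHausdorffMeasure (finrank ℝ E - finrank ℝ F)
              (A ∩ f ⁻¹' {z})) := by
      -- Degenerate L get an arbitrary positive radius: the partition only uses L = f' y with y ∈ s.
      by_cases hL : L.gram = 0
      · exact ⟨1, one_ne_zero, fun h => absurd hL h⟩
      obtain ⟨c, hc, hcA⟩ := exists_approximatesLinearOn_coarea_le hL ht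
      have hpos : 0 < √L.gram := Real.sqrt_pos.2 (L.gram_pos hL)
      have hnear : ∀ᶠ M in 𝓝 L, √M.gram < t * √L.gram :=
        (ContinuousLinearMap.continuous_gram.sqrt.tendsto L).eventually_lt_const
          (by nlinarith)
      obtain ⟨ε, hε, hball⟩ := Metric.eventually_nhds_iff.1 hnear
      refine ⟨min c (ε / 2).toNNReal, ?_, fun _ => ⟨fun M hM => (hball ?_).le, fun A f hA hf => ?_⟩⟩
      · exact (lt_min hc (Real.toNNReal_pos.2 (by linarith))).ne'
      · rw [dist_eq_norm]
        have h1 : ‖M - L‖₊ ≤ (ε / 2).toNNReal := hM.trans (min_le_right _ _)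
        have h2 : ‖M - L‖ ≤ ε / 2 := by
          have := NNReal.coe_le_coe.2 h1
          rwa [Real.coe_toNNReal _ (by linarith), coe_nnnorm] at this
        linarith
      · exact hcA A f hA (hf.mono_num (min_le_left _ _))
    choose c hc0 hc using hexists
    obtain ⟨u, L, hdisj, humeas, hcover, happrox, hL⟩ :=
      exists_partition_approximatesLinearOn_of_hasFDerivWithinAt f s f' hf' c hc0
    have hLn (k : ℕ) : (L k).gram ≠ 0 := by
      obtain ⟨y, hy, hk⟩ := hL hne k
      exact hk ▸ hgram y hy
    have hsu : s = ⋃ k, s ∩ u k := by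
      rw [← inter_iUnion, inter_eq_left.2 hcover]
    have hdisj' : Pairwise (Function.onFun Disjoint fun k => s ∩ u k) := fun i j hij =>
      (hdisj hij).mono inter_subset_right inter_subset_right
    have hpiece (k : ℕ) : ∫⁻ x in s ∩ u k, ENNReal.ofReal (√(f' x).gram)
        ≤ ENNReal.ofReal (t * t) * ∫⁻ z,
          Measure.euclideanHausdorffMeasure (finrank ℝ E - finrank ℝ F) (s ∩ u k ∩ f ⁻¹' {z}) := by
      have hm := hs.inter (humeas k)
      have h1 := (happrox k).ae_norm_fderiv_sub_le hEF hm f'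
        fun x hx => (hf' x hx.1).mono inter_subset_left
      calc ∫⁻ x in s ∩ u k, ENNReal.ofReal (√(f' x).gram)
          ≤ ∫⁻ _ in s ∩ u k, ENNReal.ofReal (t * √(L k).gram) := by
            refine lintegral_mono_ae ?_
            filter_upwards [h1] with x hx
            exact ENNReal.ofReal_le_ofReal ((hc (L k) (hLn k)).1 _ hx)
        _ = ENNReal.ofReal t * (ENNReal.ofReal (√(L k).gram) * volume (s ∩ u k)) := by
            rw [setLIntegral_const, ENNReal.ofReal_mul (by linarith), mul_assoc]
        _ ≤ _ := by
            rw [ENNReal.ofReal_mul (by linarith), mul_assoc]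
            refine mul_le_mul_right ?_ _
            exact (hc (L k) (hLn k)).2 _ f hm (happrox k)
    calc ∫⁻ x in s, ENNReal.ofReal (√(f' x).gram)
        = ∑' k, ∫⁻ x in s ∩ u k, ENNReal.ofReal (√(f' x).gram) := by
          conv_lhs => rw [hsu]
          exact lintegral_iUnion (fun k => hs.inter (humeas k)) hdisj' _
      _ ≤ ∑' k, ENNReal.ofReal (t * t) * ∫⁻ z,
          Measure.euclideanHausdorffMeasure (finrank ℝ E - finrank ℝ F) (s ∩ u k ∩ f ⁻¹' {z}) :=
          ENNReal.tsum_le_tsum hpiece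
      _ ≤ ENNReal.ofReal (t * t) * I := by
          rw [ENNReal.tsum_mul_left]
          gcongr
          refine (tsum_lintegral_le_lintegral_tsum _ _).trans (lintegral_mono fun z => ?_)
          -- Restricting the Hausdorff measure to the slice turns the sum into additivity over the
          -- disjoint measurable sets `u k`, whether or not the slice is measurable.
          rw [← Measure.restrict_apply_univ]
          refine le_trans ?_ (measure_mono (subset_univ (⋃ k, u k)))
          rw [measure_iUnion hdisj humeas]
          refine (tsum_congr fun k => ?_).le
          rw [Measure.restrict_apply (humeas k), inter_right_comm, inter_comm]
  have hlim : Tendsto (fun t : ℝ => ENNReal.ofReal (t * t) * I) (𝓝[>] 1) (𝓝 (1 * I)) := by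
    refine ENNReal.Tendsto.mul_const ?_ (Or.inl one_ne_zero)
    have h : Tendsto (fun t : ℝ => ENNReal.ofReal (t * t)) (𝓝 1) (𝓝 (ENNReal.ofReal (1 * 1))) :=
      ENNReal.tendsto_ofReal ((continuous_id.mul continuous_id).tendsto 1)
    simpa using h.mono_left nhdsWithin_le_nhds
  rw [one_mul] at hlim
  exact ge_of_tendsto hlim (by filter_upwards [self_mem_nhdsWithin] with t ht using key t ht)

end Coarea

/-! ### The coarea inequality on the state space. -/

theorem map_val_lebesgueOn {n : ℕ} {X : Set (Euc n)} (hX : NullMeasurableSet X volume) :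
    (lebesgueOn X).map Subtype.val = (volume : Measure (Euc n)).restrict X := by
  have himage : ∀ s : Set X, MeasurableSet s →
      NullMeasurableSet (Subtype.val '' s) (volume : Measure (Euc n)) := by
    rintro _ ⟨B, hB, rfl⟩
    rw [Subtype.image_preimage_coe]
    exact hX.inter hB.nullMeasurableSet
  ext B hB
  rw [Measure.map_apply measurable_subtype_coe hB, Measure.restrict_apply hB, lebesgueOn,
    Measure.comap_apply₀ _ _ Subtype.val_injective himage
      (measurable_subtype_coe hB).nullMeasurableSet, Subtype.image_preimage_coe, Set.inter_comm]

namespace MarkovSystem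

variable {n r : ℕ} (S : MarkovSystem n)

theorem aemeasurable_fderivWithin_restrict (hr : r ≤ n) {ξ : S.X → Euc r}
    (hξ : DifferentiableOn ℝ (Function.extend Subtype.val ξ 0) S.X) :
    AEMeasurable (fun x => fderivWithin ℝ (Function.extend Subtype.val ξ 0) S.X x)
      ((volume : Measure (Euc n)).restrict S.X) := by
  obtain ⟨Y, hYX, hY, hYae⟩ := S.nullMeasurableSet_X.exists_measurable_subset_ae_eq
  rw [← Measure.restrict_congr_set hYae]
  exact aemeasurable_fderivWithin_of_finrank_le (by simpa using hr) hY fun x hx =>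
    (hξ x (hYX hx)).hasFDerivWithinAt.mono hYX

theorem aemeasurable_sqrt_gramDet (hr : r ≤ n) {ξ : S.X → Euc r}
    (hξ : DifferentiableOn ℝ (Function.extend Subtype.val ξ 0) S.X) :
    AEMeasurable (fun x => ENNReal.ofReal (√(S.gramDet ξ x))) (lebesgueOn S.X) := by
  have h := S.aemeasurable_fderivWithin_restrict hr hξ
  rw [← map_val_lebesgueOn S.nullMeasurableSet_X] at h
  have h2 := h.comp_measurable measurable_subtype_coe
  have h3 : Continuous fun L : Euc n →L[ℝ] Euc r => ENNReal.ofReal (√L.gram) :=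
    ENNReal.continuous_ofReal.comp ContinuousLinearMap.continuous_gram.sqrt
  exact h3.measurable.comp_aemeasurable h2

theorem setLIntegral_sqrt_gramDet_le (hr : r ≤ n) {ξ : S.X → Euc r}
    (hξ : DifferentiableOn ℝ (Function.extend Subtype.val ξ 0) S.X)
    (hgram : ∀ᵐ x ∂lebesgueOn S.X, S.gramDet ξ x ≠ 0) {A : Set S.X} (hA : MeasurableSet A) :
    ∫⁻ x in A, ENNReal.ofReal (√(S.gramDet ξ x)) ∂lebesgueOn S.X
      ≤ ∫⁻ z, Measure.euclideanHausdorffMeasure (n - r) (A ∩ ξ ⁻¹' {z}) := by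
  set f : Euc n → Euc r := Function.extend Subtype.val ξ 0 with hf
  have hfξ (x : S.X) : f x = ξ x := Subtype.val_injective.extend_apply _ _ _
  set f' : Euc n → Euc n →L[ℝ] Euc r := fun x => fderivWithin ℝ f S.X x with hf'
  obtain ⟨B, hB, rfl⟩ := hA
  obtain ⟨Y, hYX, hY, hYae⟩ := S.nullMeasurableSet_X.exists_measurable_subset_ae_eq
  have haem := S.aemeasurable_fderivWithin_restrict hr hξ
  have h3 : Continuous fun L : Euc n →L[ℝ] Euc r => ENNReal.ofReal (√L.gram) :=
    ENNReal.continuous_ofReal.comp ContinuousLinearMap.continuous_gram.sqrt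
  have haem' : AEMeasurable (fun x => ENNReal.ofReal (√(f' x).gram)) (volume.restrict S.X) :=
    h3.measurable.comp_aemeasurable haem
  have hmap := map_val_lebesgueOn S.nullMeasurableSet_X
  have hne : ∀ᵐ x ∂volume.restrict S.X, (f' x).gram ≠ 0 := by
    have hnull : NullMeasurableSet {x | (f' x).gram ≠ 0} (volume.restrict S.X) := by
      have h4 := ContinuousLinearMap.continuous_gram.measurable.comp_aemeasurable haem
      exact h4.nullMeasurableSet_preimage (measurableSet_singleton (0 : ℝ)).compl
    rw [← hmap] at hnull ⊢
    rw [ae_iff, ← Set.compl_ofPred,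
      Measure.map_apply₀ measurable_subtype_coe.aemeasurable hnull.compl]
    exact hgram
  set N := toMeasurable (volume.restrict S.X) {x | ¬ (f' x).gram ≠ 0} with hN
  have hN0 : volume.restrict S.X N = 0 := by
    rw [hN, measure_toMeasurable]
    exact hne
  -- A Borel set of full measure in X ∩ B on which the Gram determinant never vanishes; shrinking
  -- the set can only decrease the slices.
  set s := (Y ∩ B) \ N with hs
  have hsm : MeasurableSet s := (hY.inter hB).diff (measurableSet_toMeasurable _ _)
  have hsX : s ⊆ S.X := fun x hx => hYX hx.1.1
  have hfd : ∀ x ∈ s, HasFDerivWithinAt f (f' x) s x := fun x hx =>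
    (hξ x (hsX hx)).hasFDerivWithinAt.mono hsX
  have hgs : ∀ x ∈ s, (f' x).gram ≠ 0 := by
    intro x hx h
    exact hx.2 (subset_toMeasurable _ _ (not_not.2 h))
  have hmain := lintegral_gram_le_lintegral_slices hsm hfd hgs
  rw [finrank_euclideanSpace_fin, finrank_euclideanSpace_fin] at hmain
  have hleft : ∫⁻ x in Subtype.val ⁻¹' B, ENNReal.ofReal (√(S.gramDet ξ x)) ∂lebesgueOn S.X
      = ∫⁻ x in s, ENNReal.ofReal (√(f' x).gram) := by
    have h5 : volume.restrict s = (volume.restrict S.X).restrict B := by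
      rw [Measure.restrict_restrict hB]
      refine Measure.restrict_congr_set ?_
      have hN0' : ∀ᵐ x ∂(volume : Measure (Euc n)), x ∈ S.X → x ∉ N :=
        (ae_restrict_iff'₀ S.nullMeasurableSet_X).1 (measure_eq_zero_iff_ae_notMem.1 hN0)
      filter_upwards [hYae, hN0'] with x hx hxN
      have hx' : x ∈ Y ↔ x ∈ S.X := iff_of_eq hx
      refine propext ⟨fun h => ⟨h.1.2, hYX h.1.1⟩, fun h => ⟨⟨hx'.2 h.2, h.1⟩, hxN h.2⟩⟩
    rw [h5, ← hmap, Measure.restrict_map measurable_subtype_coe hB, lintegral_map']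
    · rfl
    · rw [← Measure.restrict_map measurable_subtype_coe hB, hmap]
      exact haem'.mono_measure Measure.restrict_le_self
    · exact measurable_subtype_coe.aemeasurable
  rw [hleft]
  refine hmain.trans (lintegral_mono fun z => ?_)
  rw [← Isometry.euclideanHausdorffMeasure_image (f := (Subtype.val : S.X → Euc n))
    isometry_subtype_coe]
  refine measure_mono ?_
  rintro x ⟨hx, hxz⟩
  refine ⟨⟨x, hsX hx⟩, ⟨hx.1.2, ?_⟩, rfl⟩
  exact (hfξ ⟨x, hsX hx⟩).symm.trans hxz

theorem lintegral_mul_sqrt_gramDet_le (hr : r ≤ n) {ξ : S.X → Euc r}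
    (hξ : DifferentiableOn ℝ (Function.extend Subtype.val ξ 0) S.X)
    (hgram : ∀ᵐ x ∂lebesgueOn S.X, S.gramDet ξ x ≠ 0) {h : S.X → ℝ≥0∞} (hh : Measurable h) :
    ∫⁻ x, ENNReal.ofReal (√(S.gramDet ξ x)) * h x ∂lebesgueOn S.X
      ≤ ∫⁻ z, ∫⁻ x in ξ ⁻¹' {z}, h x ∂(Measure.euclideanHausdorffMeasure (n - r)) := by
  have hJ := S.aemeasurable_sqrt_gramDet hr hξ
  have hsimple (g : SimpleFunc S.X ℝ≥0∞) :
      ∫⁻ x, g x ∂(lebesgueOn S.X).withDensity (fun x => ENNReal.ofReal (√(S.gramDet ξ x)))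
        ≤ ∫⁻ z, ∫⁻ x in ξ ⁻¹' {z}, g x ∂(Measure.euclideanHausdorffMeasure (n - r)) := by
    induction g using SimpleFunc.induction with
    | const c hA =>
      rename_i A
      simp only [SimpleFunc.coe_piecewise, SimpleFunc.coe_const, Function.const_zero,
        Set.piecewise_eq_indicator]
      simp only [lintegral_indicator hA, Function.const_apply, setLIntegral_const,
        Measure.restrict_apply hA, withDensity_apply _ hA]
      refine (mul_le_mul_right (S.setLIntegral_sqrt_gramDet_le hr hξ hgram hA) c).trans ?_
      exact lintegral_const_mul_le _ _
    | add hd h1 h2 =>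
      rename_i g1 g2
      simp only [SimpleFunc.coe_add, Pi.add_apply]
      rw [lintegral_add_left g1.measurable]
      simp only [lintegral_add_left g1.measurable]
      exact (add_le_add h1 h2).trans (le_lintegral_add _ _)
  have h1 := lintegral_withDensity_eq_lintegral_mul₀ hJ hh.aemeasurable
  simp only [Pi.mul_apply] at h1
  rw [← h1, lintegral]
  refine iSup₂_le fun g hg => ?_
  rw [← SimpleFunc.lintegral_eq_lintegral]
  exact (hsimple g).trans (lintegral_mono fun z => lintegral_mono hg)

/-- The coarea inequality for the stationary measure and its marginals on level sets. -/
theorem lintegral_μ_le_lintegral_levelMeasure (hr : r ≤ n) {ξ : S.X → Euc r}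
    (hξ : DifferentiableOn ℝ (Function.extend Subtype.val ξ 0) S.X)
    (hgram : ∀ᵐ x ∂lebesgueOn S.X, S.gramDet ξ x ≠ 0) {g : S.X → ℝ≥0∞} (hg : Measurable g) :
    ∫⁻ x, g x ∂S.μ ≤ ∫⁻ z, ∫⁻ x, g x ∂(S.levelMeasure ξ z) := by
  have hJ := S.aemeasurable_sqrt_gramDet hr hξ
  set J : S.X → ℝ≥0∞ := fun x => ENNReal.ofReal (√(S.gramDet ξ x)) with hJdef
  have hdens : Measurable fun x => ENNReal.ofReal (S.dens x) :=
    S.dens_continuous.measurable.ennreal_ofReal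
  set N := toMeasurable (lebesgueOn S.X) {x | ¬ (J x = hJ.mk J x ∧ J x ≠ 0)}
  have hN : MeasurableSet N := measurableSet_toMeasurable _ _
  have hNae : ∀ᵐ x ∂lebesgueOn S.X, x ∉ N := by
    refine measure_eq_zero_iff_ae_notMem.1 ?_
    rw [measure_toMeasurable, ← ae_iff]
    filter_upwards [hJ.ae_eq_mk, hgram] with x h1 h2
    exact ⟨h1, (ENNReal.ofReal_pos.2 (Real.sqrt_pos.2 (ContinuousLinearMap.gram_pos h2))).ne'⟩
  have hNmem {x : S.X} (hx : x ∉ N) : J x = hJ.mk J x ∧ J x ≠ 0 := by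
    by_contra h
    exact hx (subset_toMeasurable _ _ h)
  -- A measurable minorant of π/J, equal to it almost everywhere. A Lebesgue-null set may be charged
  -- by the Hausdorff measure of a level set, so equality almost everywhere would not suffice there;
  -- w = 0 on `N` keeps w ≤ π/J at every point.
  let w : S.X → ℝ≥0∞ := Nᶜ.indicator fun x => ENNReal.ofReal (S.dens x) / hJ.mk J x
  have hw : Measurable w := (hdens.div hJ.measurable_mk).indicator hN.compl
  have hwle (x : S.X) : w x ≤ ENNReal.ofReal (S.dens x) / J x := by
    by_cases hx : x ∈ N
    · simp [w, hx]
    · simp only [w, Set.indicator_of_mem (Set.mem_compl hx), (hNmem hx).1, le_refl]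
  calc ∫⁻ x, g x ∂S.μ = ∫⁻ x, ENNReal.ofReal (S.dens x) * g x ∂lebesgueOn S.X :=
        lintegral_withDensity_eq_lintegral_mul _ hdens hg
    _ = ∫⁻ x, J x * (w x * g x) ∂lebesgueOn S.X := by
        refine lintegral_congr_ae ?_
        filter_upwards [hNae] with x hx
        simp only [w, Set.indicator_of_mem (Set.mem_compl hx), ← (hNmem hx).1]
        rw [← mul_assoc, ENNReal.mul_div_cancel (hNmem hx).2 ENNReal.ofReal_ne_top]
    _ ≤ ∫⁻ z, ∫⁻ x in ξ ⁻¹' {z}, w x * g x ∂(Measure.euclideanHausdorffMeasure (n - r)) :=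
        S.lintegral_mul_sqrt_gramDet_le hr hξ hgram (hw.mul hg)
    _ ≤ ∫⁻ z, ∫⁻ x, g x ∂(S.levelMeasure ξ z) := by
        refine lintegral_mono fun z => ?_
        refine (lintegral_withDensity_eq_lintegral_mul _ hw hg).symm.trans_le ?_
        exact lintegral_mono' (withDensity_mono (ae_of_all _ hwle)) le_rfl

end MarkovSystem

/-! ### Distances between transition densities, and measurable versions. -/

theorem enorm_toReal_sub_le {a b c : ℝ≥0∞} (ha : a ≠ ∞) (hb : b ≠ ∞) (h₁ : a ≤ b + c)
    (h₂ : b ≤ a + c) : ‖a.toReal - b.toReal‖ₑ ≤ c := by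
  rcases eq_or_ne c ∞ with rfl | hc
  · exact le_top
  rw [Real.enorm_eq_ofReal_abs]
  refine ENNReal.ofReal_le_of_le_toReal (abs_sub_le_iff.2 ⟨?_, ?_⟩)
  · have := ENNReal.toReal_mono (ENNReal.add_ne_top.2 ⟨hb, hc⟩) h₁
    rw [ENNReal.toReal_add hb hc] at this
    linarith
  · have := ENNReal.toReal_mono (ENNReal.add_ne_top.2 ⟨ha, hc⟩) h₂
    rw [ENNReal.toReal_add ha hc] at this
    linarith

theorem ofReal_le_ofReal_add_enorm_sub (a b : ℝ) :
    ENNReal.ofReal a ≤ ENNReal.ofReal b + ‖a - b‖ₑ := by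
  rw [Real.enorm_eq_ofReal_abs]
  calc ENNReal.ofReal a ≤ ENNReal.ofReal (b + |a - b|) :=
        ENNReal.ofReal_le_ofReal (by linarith [le_abs_self (a - b)])
    _ ≤ _ := ENNReal.ofReal_add_le

namespace MarkovSystem

variable {n r : ℕ} (S : MarkovSystem n)

theorem measurable_ofReal_dens : Measurable fun x => ENNReal.ofReal (S.dens x) :=
  S.dens_continuous.measurable.ennreal_ofReal

theorem measurable_ofReal_one_div_dens : Measurable fun x => ENNReal.ofReal (1 / S.dens x) :=
  (S.dens_continuous.measurable.const_div 1).ennreal_ofReal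

instance : IsProbabilityMeasure S.μ := S.isProbabilityMeasure_dens

theorem withDensity_μ :
    S.μ.withDensity (fun x => ENNReal.ofReal (1 / S.dens x)) = lebesgueOn S.X := by
  rw [μ, ← withDensity_mul _ S.measurable_ofReal_dens S.measurable_ofReal_one_div_dens]
  convert withDensity_one
  funext x
  simp only [Pi.mul_apply, Pi.one_apply]
  rw [← ENNReal.ofReal_mul (S.dens_pos x).le, mul_one_div_cancel (S.dens_pos x).ne',
    ENNReal.ofReal_one]

instance : SigmaFinite (lebesgueOn S.X) := by
  rw [← S.withDensity_μ]
  exact SigmaFinite.withDensity_ofReal _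

instance : SigmaFinite S.invWeight := SigmaFinite.withDensity_ofReal _

theorem invWeight_absolutelyContinuous : S.invWeight ≪ lebesgueOn S.X :=
  withDensity_absolutelyContinuous _ _

theorem lebesgueOn_absolutelyContinuous_invWeight : lebesgueOn S.X ≪ S.invWeight :=
  withDensity_absolutelyContinuous' S.measurable_ofReal_one_div_dens.aemeasurable
    (ae_of_all _ fun x => (ENNReal.ofReal_pos.2 (one_div_pos.2 (S.dens_pos x))).ne')

theorem lebesgueOn_absolutelyContinuous_μ : lebesgueOn S.X ≪ S.μ :=
  withDensity_absolutelyContinuous' S.measurable_ofReal_dens.aemeasurable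
    (ae_of_all _ fun x => (ENNReal.ofReal_pos.2 (S.dens_pos x)).ne')

/-- The Cauchy–Schwarz inequality `‖u‖_{L¹} ≤ ‖u‖_{L²_{1/π}}`. -/
theorem lintegral_enorm_le_eLpNorm {u : S.X → ℝ} (hu : Measurable u) :
    ∫⁻ y, ‖u y‖ₑ ∂lebesgueOn S.X ≤ eLpNorm u 2 S.invWeight := by
  -- Both norms are norms of u/π over the probability measure μ, with exponents 1 and 2.
  have h1 : ∫⁻ y, ‖u y‖ₑ ∂lebesgueOn S.X
      = ∫⁻ y, ‖u y‖ₑ * ENNReal.ofReal (1 / S.dens y) ∂S.μ := by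
    rw [μ, lintegral_withDensity_eq_lintegral_mul _ S.measurable_ofReal_dens
      (g := fun y => ‖u y‖ₑ * ENNReal.ofReal (1 / S.dens y))
      (hu.enorm.mul S.measurable_ofReal_one_div_dens)]
    refine lintegral_congr fun y => ?_
    simp only [Pi.mul_apply]
    rw [mul_left_comm, ← ENNReal.ofReal_mul (S.dens_pos y).le,
      mul_one_div_cancel (S.dens_pos y).ne', ENNReal.ofReal_one, mul_one]
  have h2 : eLpNorm u 2 S.invWeight = eLpNorm (fun y => u y * (1 / S.dens y)) 2 S.μ := by
    rw [eLpNorm_eq_lintegral_rpow_enorm_toReal (by simp) (by simp),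
      eLpNorm_eq_lintegral_rpow_enorm_toReal (by simp) (by simp), invWeight, μ,
      lintegral_withDensity_eq_lintegral_mul _ S.measurable_ofReal_one_div_dens
        (hu.enorm.pow_const _),
      lintegral_withDensity_eq_lintegral_mul _ S.measurable_ofReal_dens
        (g := fun y => ‖u y * (1 / S.dens y)‖ₑ ^ (2 : ℝ≥0∞).toReal)
        ((hu.mul (S.dens_continuous.measurable.const_div 1)).enorm.pow_const _)]
    congr 1
    refine lintegral_congr fun y => ?_
    have hpos := one_div_pos.2 (S.dens_pos y)
    simp only [Pi.mul_apply, ENNReal.toReal_ofNat, ENNReal.rpow_ofNat, enorm_mul, mul_pow]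
    rw [Real.enorm_of_nonneg hpos.le, mul_left_comm, sq (ENNReal.ofReal (1 / S.dens y)),
      ← mul_assoc (ENNReal.ofReal (S.dens y)),
      ← ENNReal.ofReal_mul (S.dens_pos y).le, mul_one_div_cancel (S.dens_pos y).ne',
      ENNReal.ofReal_one, one_mul, mul_comm]
  rw [h1, h2]
  have h3 := eLpNorm_le_eLpNorm_of_exponent_le (μ := S.μ) (p := 1) (q := 2)
    (f := fun y => u y * (1 / S.dens y)) (by norm_num)
    (hu.mul (S.dens_continuous.measurable.const_div 1)).aestronglyMeasurable
  rw [eLpNorm_one_eq_lintegral_enorm] at h3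
  refine le_trans (lintegral_mono fun y => ?_) h3
  rw [enorm_mul, Real.enorm_of_nonneg (one_div_pos.2 (S.dens_pos y)).le]

variable {S}

theorem measurable_p_right {t : ℝ} (ht : 0 < t) (x : S.X) : Measurable (S.p t x) :=
  (S.p_measurable t ht).of_uncurry_left

theorem P_apply {t : ℝ} (ht : 0 < t) (x : S.X) {B : Set S.X} (hB : MeasurableSet B) :
    S.P t x B = ∫⁻ y in B, ENNReal.ofReal (S.p t x y) ∂lebesgueOn S.X := by
  rw [S.P_eq t ht x, withDensity_apply _ hB]

/-- The Chapman–Kolmogorov equation for the densities. -/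
theorem ofReal_p_add_ae_eq {s t : ℝ} (hs : 0 < s) (ht : 0 < t) (x : S.X) :
    (fun y => ENNReal.ofReal (S.p (t + s) x y)) =ᵐ[lebesgueOn S.X] fun y =>
      ∫⁻ w, ENNReal.ofReal (S.p t x w) * ENNReal.ofReal (S.p s w y) ∂lebesgueOn S.X := by
  have hm : Measurable (Function.uncurry fun w y : S.X =>
      ENNReal.ofReal (S.p t x w) * ENNReal.ofReal (S.p s w y)) :=
    ((measurable_p_right ht x).comp measurable_fst).ennreal_ofReal.mul
      (S.p_measurable s hs).ennreal_ofReal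
  have hm' : Measurable fun y =>
      ∫⁻ w, ENNReal.ofReal (S.p t x w) * ENNReal.ofReal (S.p s w y) ∂lebesgueOn S.X :=
    hm.lintegral_prod_left
  rw [← withDensity_eq_iff_of_sigmaFinite
    (measurable_p_right (add_pos ht hs) x).ennreal_ofReal.aemeasurable hm'.aemeasurable]
  ext B hB
  rw [← S.P_eq _ (add_pos ht hs), S.chapman_kolmogorov t s ht hs, Kernel.comp_apply' _ _ _ hB,
    S.P_eq t ht x, withDensity_apply _ hB, lintegral_lintegral_swap (f := fun y w =>
      ENNReal.ofReal (S.p t x w) * ENNReal.ofReal (S.p s w y))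
      (hm.comp measurable_swap).aemeasurable,
    lintegral_withDensity_eq_lintegral_mul _ (measurable_p_right ht x).ennreal_ofReal
      ((S.P s).measurable_coe hB)]
  refine lintegral_congr fun w => ?_
  rw [lintegral_const_mul _ (measurable_p_right hs w).ennreal_ofReal, Pi.mul_apply,
    P_apply hs w hB]

theorem lintegral_ofReal_p {t : ℝ} (ht : 0 < t) (x : S.X) :
    ∫⁻ y, ENNReal.ofReal (S.p t x y) ∂lebesgueOn S.X = 1 := by
  have := S.isMarkovKernel t ht
  rw [← setLIntegral_univ, ← P_apply ht x MeasurableSet.univ, measure_univ]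

/-- The difference at time t is propagated by p^s, which spreads the mass at each w with total
weight 1. -/
theorem lintegral_enorm_p_add_sub_le {s t : ℝ} (hs : 0 < s) (ht : 0 < t) (x x' : S.X) :
    ∫⁻ y, ‖S.p (t + s) x y - S.p (t + s) x' y‖ₑ ∂lebesgueOn S.X
      ≤ ∫⁻ y, ‖S.p t x y - S.p t x' y‖ₑ ∂lebesgueOn S.X := by
  have hd : Measurable fun w => ‖S.p t x w - S.p t x' w‖ₑ :=
    ((measurable_p_right ht x).sub (measurable_p_right ht x')).enorm
  have hm : Measurable (Function.uncurry fun y w : S.X =>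
      ‖S.p t x w - S.p t x' w‖ₑ * ENNReal.ofReal (S.p s w y)) :=
    (hd.comp measurable_snd).mul ((S.p_measurable s hs).comp measurable_swap).ennreal_ofReal
  have hle (a b : S.X) (y : S.X) :
      ∫⁻ w, ENNReal.ofReal (S.p t a w) * ENNReal.ofReal (S.p s w y) ∂lebesgueOn S.X
        ≤ ∫⁻ w, ENNReal.ofReal (S.p t b w) * ENNReal.ofReal (S.p s w y) ∂lebesgueOn S.X
          + ∫⁻ w, ‖S.p t a w - S.p t b w‖ₑ * ENNReal.ofReal (S.p s w y) ∂lebesgueOn S.X := by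
    have h1 : Measurable fun w => ENNReal.ofReal (S.p t b w) * ENNReal.ofReal (S.p s w y) :=
      (measurable_p_right ht b).ennreal_ofReal.mul
        (S.p_measurable s hs).of_uncurry_right.ennreal_ofReal
    rw [← lintegral_add_left h1]
    refine lintegral_mono fun w => ?_
    rw [← add_mul]
    gcongr
    exact ofReal_le_ofReal_add_enorm_sub _ _
  calc ∫⁻ y, ‖S.p (t + s) x y - S.p (t + s) x' y‖ₑ ∂lebesgueOn S.X
      ≤ ∫⁻ y, ∫⁻ w, ‖S.p t x w - S.p t x' w‖ₑ * ENNReal.ofReal (S.p s w y)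
          ∂lebesgueOn S.X ∂lebesgueOn S.X := by
        refine lintegral_mono_ae ?_
        filter_upwards [ofReal_p_add_ae_eq hs ht x, ofReal_p_add_ae_eq hs ht x'] with y h1 h2
        have h3 := enorm_toReal_sub_le (ENNReal.ofReal_ne_top (r := S.p (t + s) x y))
          (ENNReal.ofReal_ne_top (r := S.p (t + s) x' y))
          (c := ∫⁻ w, ‖S.p t x w - S.p t x' w‖ₑ * ENNReal.ofReal (S.p s w y) ∂lebesgueOn S.X)
          (by rw [h1, h2]; exact hle x x' y)
          (by
            rw [h1, h2]
            refine (hle x' x y).trans_eq ?_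
            simp only [enorm_sub_rev])
        rwa [ENNReal.toReal_ofReal (S.p_nonneg _ (add_pos ht hs) _ _),
          ENNReal.toReal_ofReal (S.p_nonneg _ (add_pos ht hs) _ _)] at h3
    _ = ∫⁻ w, ∫⁻ y, ‖S.p t x w - S.p t x' w‖ₑ * ENNReal.ofReal (S.p s w y)
          ∂lebesgueOn S.X ∂lebesgueOn S.X := lintegral_lintegral_swap hm.aemeasurable
    _ = ∫⁻ y, ‖S.p t x y - S.p t x' y‖ₑ ∂lebesgueOn S.X := by
        refine lintegral_congr fun w => ?_
        rw [lintegral_const_mul _ (measurable_p_right hs w).ennreal_ofReal,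
          lintegral_ofReal_p hs, mul_one]

theorem lintegral_enorm_p_sub_le {τ t : ℝ} (hτ : 0 < τ) (ht : τ ≤ t) (x x' : S.X) :
    ∫⁻ y, ‖S.p t x y - S.p t x' y‖ₑ ∂lebesgueOn S.X
      ≤ ∫⁻ y, ‖S.p τ x y - S.p τ x' y‖ₑ ∂lebesgueOn S.X := by
  rcases ht.eq_or_lt with rfl | h
  · rfl
  · have := lintegral_enorm_p_add_sub_le (sub_pos.2 h) hτ x x'
    rwa [add_sub_cancel] at this

theorem enorm_density_sub {τ : ℝ} (hp : S.HasL2Densities τ) (x x' : S.X) :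
    ‖density hp x - density hp x'‖ₑ = eLpNorm (fun y => S.p τ x y - S.p τ x' y) 2 S.invWeight := by
  rw [density, density, ← MemLp.toLp_sub, Lp.enorm_toLp]
  rfl

theorem lintegral_enorm_p_sub_le_enorm_density_sub {τ : ℝ} (hτ : 0 < τ)
    (hp : S.HasL2Densities τ) (x x' : S.X) :
    ∫⁻ y, ‖S.p τ x y - S.p τ x' y‖ₑ ∂lebesgueOn S.X ≤ ‖density hp x - density hp x'‖ₑ := by
  rw [enorm_density_sub]
  exact S.lintegral_enorm_le_eLpNorm
    ((measurable_p_right hτ x).sub (measurable_p_right hτ x'))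

/-- A family of transition densities that depends measurably on the starting point, as a kernel,
has a jointly measurable version. -/
theorem exists_measurable_density {Z : Type*} [MeasurableSpace Z] (σ : Z → S.X) {t : ℝ}
    (ht : 0 < t) (hσ : Measurable fun z => S.P t (σ z)) :
    ∃ q : Z → S.X → ℝ, (∀ z y, 0 ≤ q z y) ∧ Measurable (Function.uncurry q) ∧
      ∀ z, q z =ᵐ[lebesgueOn S.X] S.p t (σ z) := by
  let κ : Kernel Z S.X := ⟨fun z => S.P t (σ z), hσ⟩
  have := S.isMarkovKernel t ht
  have hκ : IsMarkovKernel κ := ⟨fun z => inferInstanceAs (IsProbabilityMeasure (S.P t (σ z)))⟩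
  -- The derivative is taken against the finite measure μ, since Lebesgue measure on X may be
  -- infinite; the factor π converts it to a Lebesgue density.
  let η : Kernel Z S.X := Kernel.const Z S.μ
  have hd (z : Z) : Measurable fun y => κ.rnDeriv η z y := κ.measurable_rnDeriv_right η z
  refine ⟨fun z y => (ENNReal.ofReal (S.dens y) * κ.rnDeriv η z y).toReal,
    fun z y => ENNReal.toReal_nonneg, ?_, fun z => ?_⟩
  · exact ((S.measurable_ofReal_dens.comp measurable_snd).mul
      (κ.measurable_rnDeriv η)).ennreal_toReal
  · have hac : κ z ≪ η z := by
      change S.P t (σ z) ≪ S.μ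
      rw [S.P_eq t ht]
      exact (withDensity_absolutelyContinuous _ _).trans S.lebesgueOn_absolutelyContinuous_μ
    have h1 := Kernel.withDensity_rnDeriv_eq hac
    rw [Kernel.withDensity_apply _ (κ.measurable_rnDeriv η)] at h1
    have h2 : S.P t (σ z) = (lebesgueOn S.X).withDensity
        ((fun y => ENNReal.ofReal (S.dens y)) * fun y => κ.rnDeriv η z y) := by
      rw [withDensity_mul _ S.measurable_ofReal_dens (hd z)]
      exact h1.symm
    rw [S.P_eq t ht, withDensity_eq_iff_of_sigmaFinite
      (measurable_p_right ht _).ennreal_ofReal.aemeasurable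
      (S.measurable_ofReal_dens.mul (hd z)).aemeasurable] at h2
    filter_upwards [h2] with y hy
    rw [Pi.mul_apply] at hy
    rw [← hy, ENNReal.toReal_ofReal (S.p_nonneg t ht _ _)]

/-- If the densities at time `τ` depend continuously on a parameter, then the transition
probabilities at all later times depend measurably on it. -/
theorem measurable_P_of_continuous_density {Z : Type*} [TopologicalSpace Z] [MeasurableSpace Z]
    [OpensMeasurableSpace Z] {τ t : ℝ} (hτ : 0 < τ) (ht : τ ≤ t) (hp : S.HasL2Densities τ)
    {σ : Z → S.X} (hσ : Continuous fun z => density hp (σ z)) :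
    Measurable fun z => S.P t (σ z) := by
  have ht0 : 0 < t := hτ.trans_le ht
  have := S.isMarkovKernel t ht0
  refine Measure.measurable_of_measurable_coe _ fun B hB => ?_
  have hcont : Continuous fun z => (S.P t (σ z) B).toReal := by
    refine continuous_iff_continuousAt.2 fun z₀ => ?_
    rw [ContinuousAt, tendsto_iff_edist_tendsto_0]
    have hlim : Filter.Tendsto (fun z => ‖density hp (σ z) - density hp (σ z₀)‖ₑ) (nhds z₀)
        (nhds 0) := by
      have := (tendsto_iff_edist_tendsto_0.1 (hσ.tendsto z₀))
      simpa only [edist_eq_enorm_sub] using this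
    refine tendsto_of_tendsto_of_tendsto_of_le_of_le tendsto_const_nhds hlim
      (fun _ => zero_le) fun z => ?_
    have hle (a b : S.X) : S.P t a B
        ≤ S.P t b B + ∫⁻ y, ‖S.p t a y - S.p t b y‖ₑ ∂lebesgueOn S.X := by
      rw [P_apply ht0 a hB, P_apply ht0 b hB]
      refine le_trans ?_ (add_le_add_right (setLIntegral_le_lintegral B _) _)
      rw [← lintegral_add_left (measurable_p_right ht0 b).ennreal_ofReal]
      exact lintegral_mono fun y => ofReal_le_ofReal_add_enorm_sub _ _
    rw [edist_eq_enorm_sub]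
    refine (enorm_toReal_sub_le (measure_ne_top _ _) (measure_ne_top _ _)
      (hle (σ z) (σ z₀)) ?_).trans ((lintegral_enorm_p_sub_le hτ ht _ _).trans
        (lintegral_enorm_p_sub_le_enorm_density_sub hτ hp _ _))
    refine (hle (σ z₀) (σ z)).trans_eq ?_
    simp only [enorm_sub_rev]
  have h := hcont.measurable.ennreal_ofReal
  simpa only [ENNReal.ofReal_toReal (measure_ne_top _ _)] using h

namespace ParametrizedManifold

variable {τ : ℝ} {hp : S.HasL2Densities τ} (W : ParametrizedManifold hp r)

theorem extend_rcVal (x : S.X) : Function.extend Subtype.val W.rcVal 0 (x : Euc n) = W.rcVal x :=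
  Subtype.val_injective.extend_apply _ _ _

theorem IsWeakTransitionManifold.continuous_rc {W : ParametrizedManifold hp r} {ε : ℝ}
    (hW : W.IsWeakTransitionManifold ε) : Continuous W.rc := by
  have h := continuousOn_iff_continuous_domRestrict.1 hW.differentiableOn.continuousOn
  have h2 : S.X.domRestrict (Function.extend Subtype.val W.rcVal 0) = W.rcVal :=
    funext fun x => W.extend_rcVal x
  rw [h2] at h
  exact continuous_induced_rng.2 h

theorem rc_eq_iff {x x' : S.X} : W.rcVal x' = W.rcVal x ↔ W.proj x' = W.proj x := by
  rw [rcVal, rcVal, Subtype.coe_inj, rc, rc, W.E.injective.eq_iff]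

/-- By the coarea inequality it suffices to bound the integral over each level set: by ε when z is
attained by ξ, and by 0 otherwise, hence by ε·1_Z. -/
theorem IsWeakTransitionManifold.lintegral_enorm_le {W : ParametrizedManifold hp r} {ε : ℝ}
    (hW : W.IsWeakTransitionManifold ε) (hr : r ≤ n)
    (hmeas : Measurable fun x => ‖(W.proj x : Lp ℝ 2 S.invWeight) - density hp x‖ₑ) :
    ∫⁻ x, ‖(W.proj x : Lp ℝ 2 S.invWeight) - density hp x‖ₑ ∂S.μ
      ≤ ENNReal.ofReal ε * volume W.Z := by
  refine (S.lintegral_μ_le_lintegral_levelMeasure hr hW.differentiableOn hW.gramDet_ne_zero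
    hmeas).trans ?_
  have hcont : Continuous W.rcVal := continuous_subtype_val.comp hW.continuous_rc
  have hlevel (z : Euc r) (G : S.X → ℝ≥0∞) :
      ∫⁻ x in {x | W.rcVal x = z}, G x ∂S.levelMeasure W.rcVal z
        = ∫⁻ x, G x ∂S.levelMeasure W.rcVal z := by
    have hm : MeasurableSet {x | W.rcVal x = z} := hcont.measurable (measurableSet_singleton z)
    rw [levelMeasure, restrict_withDensity hm, Measure.restrict_restrict hm, Set.inter_self]
  have hle (z : Euc r) :
      ∫⁻ x, ‖(W.proj x : Lp ℝ 2 S.invWeight) - density hp x‖ₑ ∂S.levelMeasure W.rcVal z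
        ≤ W.Z.indicator (fun _ => ENNReal.ofReal ε) z := by
    by_cases hz : ∃ x, W.rcVal x = z
    · obtain ⟨x, rfl⟩ := hz
      rw [Set.indicator_of_mem (show W.rcVal x ∈ W.Z from (W.rc x).2), ← hlevel]
      have hset : {x' | W.rcVal x' = W.rcVal x} = {x' | W.proj x' = W.proj x} :=
        Set.ext fun x' => W.rc_eq_iff
      rw [hset]
      exact hW.close x
    · have hempty : {x | W.rcVal x = z} = ∅ :=
        Set.eq_empty_of_forall_notMem fun x hx => hz ⟨x, hx⟩
      rw [← hlevel, hempty, Measure.restrict_empty, lintegral_zero_measure]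
      exact zero_le
  refine (lintegral_mono hle).trans_eq ?_
  rw [lintegral_indicator_const W.isOpen.measurableSet]

theorem IsWeakTransitionManifold.exists_isLumpableVia {W : ParametrizedManifold hp r} {ε : ℝ}
    (hW : W.IsWeakTransitionManifold ε) (hr : r ≤ n) (hτ : 0 < τ) :
    ∃ (ξ : C(S.X, W.Z)) (pL : ℝ → W.Z → S.X → ℝ),
      (∀ x, ξ x = W.rc x) ∧
      (∀ z : W.Z, pL τ z =ᵐ[lebesgueOn S.X] ((W.E.symm z : Lp ℝ 2 S.invWeight) : S.X → ℝ)) ∧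
      S.IsLumpableVia ε τ W.Z ξ pL := by
  -- An arbitrary choice of representatives; only z ↦ p^τ(σ(z),·) = E⁻¹(z) is known to be
  -- continuous.
  have hex (z : W.Z) : ∃ x, density hp x = W.E.symm z := W.subset (W.E.symm z).2
  choose σ hσ using hex
  have hσc : Continuous fun z => density hp (σ z) := by
    simp only [hσ]
    exact continuous_subtype_val.comp W.E.symm.continuous
  have hproj (x : S.X) : (W.proj x : Lp ℝ 2 S.invWeight) = density hp (σ (W.rc x)) := by
    rw [hσ, rc, W.E.symm_apply_apply]
  have hq (t : ℝ) : ∃ q : W.Z → S.X → ℝ, τ ≤ t → (∀ z y, 0 ≤ q z y) ∧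
      Measurable (Function.uncurry q) ∧ ∀ z, q z =ᵐ[lebesgueOn S.X] S.p t (σ z) := by
    by_cases ht : τ ≤ t
    · obtain ⟨q, h⟩ := exists_measurable_density σ (hτ.trans_le ht)
        (measurable_P_of_continuous_density hτ ht hp hσc)
      exact ⟨q, fun _ => h⟩
    · exact ⟨0, fun h => absurd h ht⟩
  choose pL hpL using hq
  -- Replacing Q(x) by the jointly measurable version `pL τ` at ξ(x) makes the norm an integral with
  -- a measurable parameter.
  have hmeas : Measurable fun x => ‖(W.proj x : Lp ℝ 2 S.invWeight) - density hp x‖ₑ := by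
    have h1 (x : S.X) : ‖(W.proj x : Lp ℝ 2 S.invWeight) - density hp x‖ₑ
        = (∫⁻ y, ‖pL τ (W.rc x) y - S.p τ x y‖ₑ ^ (2 : ℝ) ∂S.invWeight) ^ (1 / (2 : ℝ)) := by
      rw [hproj, enorm_density_sub, eLpNorm_eq_lintegral_rpow_enorm_toReal (by simp) (by simp)]
      simp only [ENNReal.toReal_ofNat]
      congr 1
      refine lintegral_congr_ae ?_
      filter_upwards [S.invWeight_absolutelyContinuous.ae_eq ((hpL τ le_rfl).2.2 (W.rc x))]
        with y hy
      rw [hy]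
    simp only [h1]
    have h2 : Measurable (Function.uncurry fun x y => pL τ (W.rc x) y - S.p τ x y) :=
      ((hpL τ le_rfl).2.1.comp ((hW.continuous_rc.measurable.comp measurable_fst).prodMk
        measurable_snd)).sub (S.p_measurable τ hτ)
    exact ((h2.enorm.pow_const (2 : ℝ)).lintegral_prod_right').pow_const _
  have hbound := hW.lintegral_enorm_le hr hmeas
  refine ⟨⟨W.rc, hW.continuous_rc⟩, pL, fun x => rfl, fun z => ?_, hτ, W.isOpen, W.isConnected,
    fun t ht => (hpL t ht).1, fun t ht => (hpL t ht).2.1, fun t ht => ?_⟩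
  · refine ((hpL τ le_rfl).2.2 z).trans ?_
    rw [← hσ]
    exact (S.lebesgueOn_absolutelyContinuous_invWeight.ae_eq (hp (σ z)).coeFn_toLp).symm
  · have hk : S.kNorm (fun x y => S.p t x y - pL t (W.rc x) y) ≤ ENNReal.ofReal ε * volume W.Z := by
      refine le_trans (lintegral_mono fun x => ?_) hbound
      calc ∫⁻ y, ‖S.p t x y - pL t (W.rc x) y‖ₑ ∂lebesgueOn S.X
          = ∫⁻ y, ‖S.p t x y - S.p t (σ (W.rc x)) y‖ₑ ∂lebesgueOn S.X := by
            refine lintegral_congr_ae ?_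
            filter_upwards [(hpL t ht).2.2 (W.rc x)] with y hy
            rw [hy]
        _ ≤ _ := lintegral_enorm_p_sub_le hτ ht _ _
        _ ≤ _ := lintegral_enorm_p_sub_le_enorm_density_sub hτ hp _ _
        _ = _ := by rw [hproj, enorm_sub_rev]
    -- This includes |Z| = ∞, where the inverse is 0.
    rw [← ENNReal.div_eq_inv_mul]
    exact ENNReal.div_le_of_le_mul hk

end ParametrizedManifold

end MarkovSystem

theorem mainTheorem5 {n r : ℕ} (hr : r ≤ n) (S : MarkovSystem n) (ε τ : ℝ) (hε : 0 < ε)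
    (hτ : 0 < τ) (hp : S.HasL2Densities τ)
    (hred : MarkovSystem.IsWeaklyReducible ε r hp) :
    (∃ (Z : Set (Euc r)) (ξ : C(S.X, Z)) (pL : ℝ → Z → S.X → ℝ),
      S.IsLumpableVia ε τ Z ξ pL) ∧
    ∀ W : MarkovSystem.ParametrizedManifold hp r, W.IsWeakTransitionManifold ε →
      ∃ (ξ : C(S.X, W.Z)) (pL : ℝ → W.Z → S.X → ℝ),
        (∀ x, ξ x = W.E (W.Q ⟨MarkovSystem.density hp x, Set.mem_range_self x⟩)) ∧
        (∀ z : W.Z, pL τ z =ᵐ[lebesgueOn S.X] ((W.E.symm z : Lp ℝ 2 S.invWeight) : S.X → ℝ)) ∧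
        S.IsLumpableVia ε τ W.Z ξ pL := by
  refine ⟨?_, fun W hW => hW.exists_isLumpableVia hr hτ⟩
  obtain ⟨W, hW⟩ := hred
  obtain ⟨ξ, pL, -, -, h⟩ := hW.exists_isLumpableVia hr hτ
  exact ⟨W.Z, ξ, pL, h⟩
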